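/- \textbf{Smooth loopoids.} Let $G$ and $M$ be smooth finite-dimensional (Hausdorff, boundaryless) manifolds. A \emph{smooth loopoid} $G\rightrightarrows M$ consists of surjective submersions $\alpha,\beta:G\to M$ (target and source), a smooth embedding $\varepsilon:M\to G$ of the units, by which $M$ is regarded as a submanifold of $G$, with $\alpha\circ\varepsilon=\beta\circ\varepsilon=\mathrm{id}_M$, and a smooth multiplication $G^{(2)}\to G$, $(g,h)\mapsto gh$, defined on $G^{(2)}=\{(g,h)\in G\times G:\beta(g)=\alpha(h)\}$, such that $$\alpha(g)g=g,\quad g\beta(g)=g,\quad \alpha(gh)=\alpha(g),\quad \beta(gh)=\beta(h),$$ and such that for all $g,h\in G$ the translations $l_g:\alpha^{-1}(\beta(g))\to\alpha^{-1}(\alpha(g))$, $x\mapsto gx$, and $r_h:\beta^{-1}(\alpha(h))\to\beta^{-1}(\beta(h))$, $x\mapsto xh$, are diffeomorphisms. No associativity or existence of inverses is assumed. \textbf{Prolongations.} Let $AG=\mathsf TG|_M/\mathsf TM\to M$ be the normal bundle of the units and $A^*G$ its dual bundle. For $X\in A_mG$ let $\bar X^\alpha\in\ker \mathsf T_m\alpha$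 and $\bar X^\beta\in\ker\mathsf T_m\beta$ be the unique representatives of $X$ tangent to the $\alpha$-fibre, respectively the $\beta$-fibre, through $m$. For a smooth section $X$ of $AG$, its left and right prolongations are the vector fields on $G$ $$\overleftarrow{X}(g)=\mathsf T_{\beta(g)}l_g\big(\bar X^\alpha(\beta(g))\big),\qquad \overrightarrow{X}(g)=\mathsf T_{\alpha(g)}r_g\big(\bar X^\beta(\alpha(g))\big).$$ The maps $\tilde\alpha,\tilde\beta:\mathsf T^*G\to A^*G$ send $\mu\in \mathsf T_g^*G$ to $\tilde\alpha(\mu)\in A^*_{\alpha(g)}G$ and $\tilde\beta(\mu)\in A^*_{\beta(g)}G$, given by $$\langle\tilde\beta(\mu),X\rangle=\langle\mu,\mathsf T_{\beta(g)}l_g(\bar X^\alpha)\rangle\ \ (X\in A_{\beta(g)}G),\qquad \langle\tilde\alpha(\mu),Y\rangle=\langle\mu,\mathsf T_{\alpha(g)}r_g(\bar Y^\beta)\rangle\ \ (Y\in A_{\alpha(g)}G).$$ \textbf{Theorem.} Let $G\rightrightarrows M$ be a smooth loopoid, $L:G\to\mathbb R$ a smooth function, $n\ge 0$ and $\mu_1,\dots,\mu_n\in\mathsf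 T^*G$. The following are equivalent: \begin{enumerate} \item $\mu_k\in \mathrm dL(G)$ for $k=1,\dots,n$, and $\tilde\beta(\mu_k)=\tilde\alpha(\mu_{k+1})$ in $A^*G$ for $k=1,\dots,n-1$; \item there are $g_1,\dots,g_n\in G$ with $\mu_k=\mathrm dL(g_k)$ for $k=1,\dots,n$ such that, for $k=1,\dots,n-1$, $(g_k,g_{k+1})\in G^{(2)}$, i.e. $\beta(g_k)=\alpha(g_{k+1})$, and the discrete Euler--Lagrange equations $$\overleftarrow{X}(L)(g_k)=\overrightarrow{X}(L)(g_{k+1})$$ hold for every smooth section $X$ of $AG$. \end{enumerate} -/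

import Mathlib

open scoped Manifold ContDiff Topology

/-- Finite-dimensional submanifolds `S`, `T` of `G` are given by their point sets.  `f` restricts to a
diffeomorphism `S → T`: it is smooth on `S`, maps `S` bijectively onto `T`, and its inverse is
smooth on `T`.  (On an embedded submanifold, `ContMDiffOn` says that the restriction is smooth.) -/
def IsDiffeoBetween {E : Type*} [NormedAddCommGroup E] [NormedSpace ℝ E]
    {G : Type*} [TopologicalSpace G] [ChartedSpace E G] (f : G → G) (S T : Set G) : Prop :=
  ContMDiffOn 𝓘(ℝ, E) 𝓘(ℝ, E) ∞ f S ∧ Set.MapsTo f S T ∧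
    ∃ k : G → G, ContMDiffOn 𝓘(ℝ, E) 𝓘(ℝ, E) ∞ k T ∧ Set.MapsTo k T S ∧ Set.InvOn k f S T

/-- A smooth loopoid `G ⇉ M`, with target `α`, source `β` and embedding `ε` of the manifold of units.
The product `g h` is meaningful only if `β g = α h`: no axiom and no later definition involves the
value of `mul` at other pairs.  As `α` and `β` are submersions, the set of composable pairs is a
closed embedded submanifold of `G × G` and the fibres of `α` and `β` are embedded submanifolds
of `G`. -/
structure SmoothLoopoid (E E' : Type*) [NormedAddCommGroup E] [NormedSpace ℝ E]
    [NormedAddCommGroup E'] [NormedSpace ℝ E']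
    (G M : Type*) [TopologicalSpace G] [ChartedSpace E G]
    [TopologicalSpace M] [ChartedSpace E' M] where
  /-- target map -/
  α : G → M
  /-- source map -/
  β : G → M
  /-- embedding of the units -/
  ε : M → G
  /-- partial multiplication -/
  mul : G → G → G
  submersion_α : Manifold.IsSubmersion 𝓘(ℝ, E) 𝓘(ℝ, E') ∞ α
  submersion_β : Manifold.IsSubmersion 𝓘(ℝ, E) 𝓘(ℝ, E') ∞ β
  surjective_α : Function.Surjective α
  surjective_β : Function.Surjective β
  embedding_ε : Manifold.IsSmoothEmbedding 𝓘(ℝ, E') 𝓘(ℝ, E) ∞ ε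
  α_ε : ∀ m, α (ε m) = m
  β_ε : ∀ m, β (ε m) = m
  smooth_mul : ContMDiffOn (𝓘(ℝ, E).prod 𝓘(ℝ, E)) 𝓘(ℝ, E) ∞ (fun p : G × G => mul p.1 p.2)
    {p : G × G | β p.1 = α p.2}
  unit_mul : ∀ h, mul (ε (α h)) h = h
  mul_unit : ∀ g, mul g (ε (β g)) = g
  α_mul : ∀ g h, β g = α h → α (mul g h) = α g
  β_mul : ∀ g h, β g = α h → β (mul g h) = β h
  /-- the left translation by `g`, from the `α`-fibre over `β g` to the `α`-fibre over `α g` -/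
  left_translation : ∀ g,
    IsDiffeoBetween (E := E) (fun h => mul g h) {h | α h = β g} {h | α h = α g}
  /-- the right translation by `h`, from the `β`-fibre over `α h` to the `β`-fibre over `β h` -/
  right_translation : ∀ h,
    IsDiffeoBetween (E := E) (fun g => mul g h) {g | β g = α h} {g | β g = β h}

namespace SmoothLoopoid

variable {E E' : Type*} [NormedAddCommGroup E] [NormedSpace ℝ E]
  [NormedAddCommGroup E'] [NormedSpace ℝ E']
  {G M : Type*} [TopologicalSpace G] [ChartedSpace E G]
  [TopologicalSpace M] [ChartedSpace E' M]

/-- Linear algebra: `range i` and `ker p` are complementary if `p ∘ i = id`. -/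
theorem isCompl_range_ker {V W : Type*} [AddCommGroup V] [Module ℝ V] [AddCommGroup W] [Module ℝ W]
    (i : W →ₗ[ℝ] V) (p : V →ₗ[ℝ] W) (h : ∀ w, p (i w) = w) :
    IsCompl (LinearMap.range i) (LinearMap.ker p) := by
  constructor
  · rw [Submodule.disjoint_def]
    rintro x ⟨w, rfl⟩ hx
    have hw : w = 0 := by rw [← h w]; exact hx
    rw [hw, map_zero]
  · rw [codisjoint_iff, eq_top_iff]
    intro x _
    refine Submodule.mem_sup.2 ⟨i (p x), ⟨p x, rfl⟩, x - i (p x), ?_, by abel⟩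
    rw [LinearMap.mem_ker, map_sub, h, sub_self]

theorem mfderiv_section (ε : M → G) (π : G → M)
    (hε : Manifold.IsSmoothEmbedding 𝓘(ℝ, E') 𝓘(ℝ, E) ∞ ε)
    (hπ : Manifold.IsSubmersion 𝓘(ℝ, E) 𝓘(ℝ, E') ∞ π) (h : ∀ m, π (ε m) = m) (m : M)
    (w : TangentSpace 𝓘(ℝ, E') m) :
    mfderiv 𝓘(ℝ, E) 𝓘(ℝ, E') π (ε m) (mfderiv 𝓘(ℝ, E') 𝓘(ℝ, E) ε m w) = w := by
  have h1 : MDifferentiableAt 𝓘(ℝ, E') 𝓘(ℝ, E) ε m :=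
    hε.isImmersion.contMDiff.mdifferentiableAt (by simp)
  have h2 : MDifferentiableAt 𝓘(ℝ, E) 𝓘(ℝ, E') π (ε m) :=
    hπ.contMDiff.mdifferentiableAt (by simp)
  have h3 := mfderiv_comp m h2 h1
  have h4 : π ∘ ε = id := funext h
  rw [h4, mfderiv_id] at h3
  exact (DFunLike.congr_fun h3 w).symm

variable (Γ : SmoothLoopoid E E' G M)

/-- The tangent space `T_{ε m} M` of the submanifold of units, inside `T_{ε m} G`. -/
noncomputable abbrev unitTangent (m : M) : Submodule ℝ (TangentSpace 𝓘(ℝ, E) (Γ.ε m)) :=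
  LinearMap.range (mfderiv 𝓘(ℝ, E') 𝓘(ℝ, E) Γ.ε m).toLinearMap

/-- The tangent space at the unit `ε m` of the `α`-fibre over `m`. -/
noncomputable abbrev alphaTangent (m : M) : Submodule ℝ (TangentSpace 𝓘(ℝ, E) (Γ.ε m)) :=
  LinearMap.ker (mfderiv 𝓘(ℝ, E) 𝓘(ℝ, E') Γ.α (Γ.ε m)).toLinearMap

/-- The tangent space at the unit `ε m` of the `β`-fibre over `m`. -/
noncomputable abbrev betaTangent (m : M) : Submodule ℝ (TangentSpace 𝓘(ℝ, E) (Γ.ε m)) :=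
  LinearMap.ker (mfderiv 𝓘(ℝ, E) 𝓘(ℝ, E') Γ.β (Γ.ε m)).toLinearMap

theorem isCompl_alpha (m : M) : IsCompl (Γ.unitTangent m) (Γ.alphaTangent m) :=
  isCompl_range_ker (V := TangentSpace 𝓘(ℝ, E) (Γ.ε m)) (W := TangentSpace 𝓘(ℝ, E') m)
    (mfderiv 𝓘(ℝ, E') 𝓘(ℝ, E) Γ.ε m).toLinearMap
    (mfderiv 𝓘(ℝ, E) 𝓘(ℝ, E') Γ.α (Γ.ε m)).toLinearMap
    (mfderiv_section Γ.ε Γ.α Γ.embedding_ε Γ.submersion_α Γ.α_ε m)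

theorem isCompl_beta (m : M) : IsCompl (Γ.unitTangent m) (Γ.betaTangent m) :=
  isCompl_range_ker (V := TangentSpace 𝓘(ℝ, E) (Γ.ε m)) (W := TangentSpace 𝓘(ℝ, E') m)
    (mfderiv 𝓘(ℝ, E') 𝓘(ℝ, E) Γ.ε m).toLinearMap
    (mfderiv 𝓘(ℝ, E) 𝓘(ℝ, E') Γ.β (Γ.ε m)).toLinearMap
    (mfderiv_section Γ.ε Γ.β Γ.embedding_ε Γ.submersion_β Γ.β_ε m)

/-- The fibre at `m` of the normal bundle `AG = ν(G, M) = TG|_M / TM`. -/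
abbrev AFiber (m : M) : Type _ :=
  TangentSpace 𝓘(ℝ, E) (Γ.ε m) ⧸ Γ.unitTangent m

/-- `X ↦ X̄^α`: the vector tangent to the `α`-fibre that represents a given normal vector. -/
noncomputable def alphaRep (m : M) : Γ.AFiber m ≃ₗ[ℝ] Γ.alphaTangent m :=
  Submodule.quotientEquivOfIsCompl (Γ.unitTangent m) (Γ.alphaTangent m) (Γ.isCompl_alpha m)

/-- `X ↦ X̄^β`: the vector tangent to the `β`-fibre that represents a given normal vector. -/
noncomputable def betaRep (m : M) : Γ.AFiber m ≃ₗ[ℝ] Γ.betaTangent m :=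
  Submodule.quotientEquivOfIsCompl (Γ.unitTangent m) (Γ.betaTangent m) (Γ.isCompl_beta m)

/-- `X ↦ T_{β g} l_g (X̄^α)`, from `A_{β g} G` to `T_g G`.  The derivative is taken within the
`α`-fibre, and only its (uniquely determined) restriction to the tangent space of that fibre is
used.  The cast along `g (β g) = g` identifies `T_{g (β g)} G` with `T_g G`. -/
noncomputable def leftLift (g : G) : Γ.AFiber (Γ.β g) →ₗ[ℝ] TangentSpace 𝓘(ℝ, E) g :=
  ((Eq.rec (motive := fun x _ =>
      TangentSpace 𝓘(ℝ, E) (Γ.ε (Γ.β g)) →L[ℝ] TangentSpace 𝓘(ℝ, E) x)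
    (mfderivWithin 𝓘(ℝ, E) 𝓘(ℝ, E) (fun h => Γ.mul g h) {h | Γ.α h = Γ.β g} (Γ.ε (Γ.β g)))
    (Γ.mul_unit g) : _ →L[ℝ] _) : _ →ₗ[ℝ] _) ∘ₗ
      (Γ.alphaTangent (Γ.β g)).subtype ∘ₗ (Γ.alphaRep (Γ.β g) : _ →ₗ[ℝ] _)

/-- `X ↦ T_{α h} r_h (X̄^β)`, from `A_{α h} G` to `T_h G`. -/
noncomputable def rightLift (h : G) : Γ.AFiber (Γ.α h) →ₗ[ℝ] TangentSpace 𝓘(ℝ, E) h :=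
  ((Eq.rec (motive := fun x _ =>
      TangentSpace 𝓘(ℝ, E) (Γ.ε (Γ.α h)) →L[ℝ] TangentSpace 𝓘(ℝ, E) x)
    (mfderivWithin 𝓘(ℝ, E) 𝓘(ℝ, E) (fun g => Γ.mul g h) {g | Γ.β g = Γ.α h} (Γ.ε (Γ.α h)))
    (Γ.unit_mul h) : _ →L[ℝ] _) : _ →ₗ[ℝ] _) ∘ₗ
      (Γ.betaTangent (Γ.α h)).subtype ∘ₗ (Γ.betaRep (Γ.α h) : _ →ₗ[ℝ] _)

/-- A smooth section of the normal bundle `AG`: locally it is the class of a smooth vector field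
along `ε` with values in `TG`. -/
structure ASection [IsManifold 𝓘(ℝ, E) ∞ G] where
  /-- the value of the section at a point of `M` -/
  toFun : ∀ m : M, Γ.AFiber m
  smooth : ∀ m₀ : M, ∃ U ∈ 𝓝 m₀, ∃ V : ∀ m : M, TangentSpace 𝓘(ℝ, E) (Γ.ε m),
    ContMDiffOn 𝓘(ℝ, E') 𝓘(ℝ, E).tangent ∞
      (fun m => (⟨Γ.ε m, V m⟩ : TangentBundle 𝓘(ℝ, E) G)) U ∧
    ∀ m ∈ U, toFun m = Submodule.Quotient.mk (V m)

/-- The left prolongation of a section of `AG`, a vector field on `G`. -/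
noncomputable def leftProlongation [IsManifold 𝓘(ℝ, E) ∞ G] (X : Γ.ASection) (g : G) :
    TangentSpace 𝓘(ℝ, E) g :=
  Γ.leftLift g (X.toFun (Γ.β g))

/-- The right prolongation of a section of `AG`, a vector field on `G`. -/
noncomputable def rightProlongation [IsManifold 𝓘(ℝ, E) ∞ G] (X : Γ.ASection) (h : G) :
    TangentSpace 𝓘(ℝ, E) h :=
  Γ.rightLift h (X.toFun (Γ.α h))

variable (E G) in
/-- The cotangent bundle `T*G`, as a set. -/
abbrev Cotangent : Type _ := Σ g : G, (TangentSpace 𝓘(ℝ, E) g →L[ℝ] ℝ)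

/-- The dual bundle `A*G`, as a set: a point of the base and a covector over that point. -/
abbrev ADual : Type _ := Σ m : M, Module.Dual ℝ (Γ.AFiber m)

/-- `α̃ : T*G → A*G`. -/
noncomputable def alphaTilde (ν : Cotangent E G) : Γ.ADual :=
  ⟨Γ.α ν.1, (ν.2 : TangentSpace 𝓘(ℝ, E) ν.1 →ₗ[ℝ] ℝ) ∘ₗ Γ.rightLift ν.1⟩

/-- `β̃ : T*G → A*G`. -/
noncomputable def betaTilde (μ : Cotangent E G) : Γ.ADual :=
  ⟨Γ.β μ.1, (μ.2 : TangentSpace 𝓘(ℝ, E) μ.1 →ₗ[ℝ] ℝ) ∘ₗ Γ.leftLift μ.1⟩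

/-- The differential `dL : G → T*G` of a function. -/
noncomputable def dL (L : G → ℝ) (g : G) : Cotangent E G :=
  ⟨g, mfderiv 𝓘(ℝ, E) 𝓘(ℝ, ℝ) L g⟩

/-- The derivative at `g` of a function along a vector field. -/
noncomputable def lieDeriv (X : ∀ g : G, TangentSpace 𝓘(ℝ, E) g) (L : G → ℝ) (g : G) : ℝ :=
  mfderiv 𝓘(ℝ, E) 𝓘(ℝ, ℝ) L g (X g)

/-- `μ_1, …, μ_n` lie in `dL(G)` and consecutive ones are composable. -/
def IsDiscreteLagrangianDynamics (L : G → ℝ) {n : ℕ} (μ : Fin n → Cotangent E G) : Prop :=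
  (∀ k, μ k ∈ Set.range (dL (E := E) L)) ∧
    ∀ i j : Fin n, (i : ℕ) + 1 = j → Γ.betaTilde (μ i) = Γ.alphaTilde (μ j)

/-- The discrete Euler–Lagrange equations at a pair `(g, h)`. -/
def DiscreteEulerLagrange [IsManifold 𝓘(ℝ, E) ∞ G] (L : G → ℝ) (g h : G) : Prop :=
  ∀ X : Γ.ASection,
    lieDeriv (Γ.leftProlongation X) L g = lieDeriv (Γ.rightProlongation X) L h

end SmoothLoopoid

namespace SmoothLoopoid

variable {E E' : Type*} [NormedAddCommGroup E] [NormedSpace ℝ E]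
  [NormedAddCommGroup E'] [NormedSpace ℝ E']
  {G M : Type*} [TopologicalSpace G] [ChartedSpace E G]
  [TopologicalSpace M] [ChartedSpace E' M]

/-! A covector in `dL(G)` remembers its base point, so the points `g_k` are forced, and the theorem
reduces to one consecutive pair `(g, h)`. Equality of `β̃(dL(g))` and `α̃(dL(h))` in `A*G` means
that the base points `β g` and `α h` agree, which is composability, and that two functionals on that
fibre of `AG` agree. On the value of a section `X` these functionals give the derivatives of `L`
along the left and right prolongations of `X`. So the Euler–Lagrange equations test the functionals
on values of smooth sections only; `exists_aSection_apply_eq` shows that such values fill each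
fibre. -/

/-- Every tangent vector of a finite-dimensional Hausdorff manifold is the value of a globally
smooth vector field. -/
theorem exists_smooth_vectorField [FiniteDimensional ℝ E] [T2Space G] [IsManifold 𝓘(ℝ, E) ∞ G]
    (x : G) (v : TangentSpace 𝓘(ℝ, E) x) :
    ∃ W : ∀ y : G, TangentSpace 𝓘(ℝ, E) y,
      ContMDiff 𝓘(ℝ, E) 𝓘(ℝ, E).tangent ∞ (fun y => (⟨y, W y⟩ : TangentBundle 𝓘(ℝ, E) G)) ∧
        W x = v := by
  obtain ⟨s, hs, hW⟩ := FiberBundle.exists_contMDiffOn_extend (k := ∞) 𝓘(ℝ, E) E v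
  obtain ⟨u, hus, hu, hxu⟩ := mem_nhds_iff.1 hs
  -- The local extension of `v` is smooth only near `x`. A bump function with closed support in `u`,
  -- equal to 1 at `x`, makes it global without changing its value at `x`.
  obtain ⟨f, -, hf⟩ :=
    (SmoothBumpFunction.nhds_basis_tsupport (I := 𝓘(ℝ, E)) x).mem_iff.1 (hu.mem_nhds hxu)
  refine ⟨(f : G → ℝ) • FiberBundle.extend E v,
    ContMDiffOn.smul_section_of_tsupport f.contMDiff.contMDiffOn hu hf (hW.mono hus), ?_⟩
  simp

variable (Γ : SmoothLoopoid E E' G M)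

/-- Every point of the normal bundle `AG` lies on a smooth section. -/
theorem exists_aSection_apply_eq [FiniteDimensional ℝ E] [T2Space G] [IsManifold 𝓘(ℝ, E) ∞ G]
    (m : M) (a : Γ.AFiber m) : ∃ X : Γ.ASection, X.toFun m = a := by
  obtain ⟨v, rfl⟩ := Submodule.Quotient.mk_surjective _ a
  obtain ⟨W, hW, hWm⟩ := exists_smooth_vectorField (Γ.ε m) v
  -- Restricting the global field `W` to the units gives one representative valid on all of `M`, so
  -- the neighbourhood can be `Set.univ`.
  refine ⟨⟨fun p => Submodule.Quotient.mk (W (Γ.ε p)), fun _ => ⟨Set.univ, Filter.univ_mem,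
    fun p => W (Γ.ε p), ?_, fun _ _ => rfl⟩⟩, congrArg _ hWm⟩
  exact (hW.comp Γ.embedding_ε.isImmersion.contMDiff).contMDiffOn

/-- Two points of `A*G` agree iff they have the same base point and the same pairing with every
smooth section of `AG`. -/
theorem aDual_eq_iff [FiniteDimensional ℝ E] [T2Space G] [IsManifold 𝓘(ℝ, E) ∞ G]
    (φ ψ : Γ.ADual) :
    φ = ψ ↔ φ.1 = ψ.1 ∧
      ∀ X : Γ.ASection, φ.2 (X.toFun φ.1) = ψ.2 (X.toFun ψ.1) := by
  refine ⟨fun h => h ▸ ⟨rfl, fun _ => rfl⟩, ?_⟩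
  obtain ⟨m, φ⟩ := φ
  obtain ⟨m', ψ⟩ := ψ
  -- The functionals have a common domain only once the base points are identified.
  rintro ⟨rfl : m = m', h⟩
  congr 1
  refine LinearMap.ext fun a => ?_
  obtain ⟨X, rfl⟩ := Γ.exists_aSection_apply_eq m a
  exact h X

/-- The covectors `dL(g)` and `dL(h)` are composable iff `g` and `h` are and the discrete
Euler–Lagrange equations hold at `(g, h)`. -/
theorem betaTilde_dL_eq_alphaTilde_dL_iff [FiniteDimensional ℝ E] [T2Space G]
    [IsManifold 𝓘(ℝ, E) ∞ G] (L : G → ℝ) (g h : G) :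
    Γ.betaTilde (dL L g) = Γ.alphaTilde (dL L h) ↔
      Γ.β g = Γ.α h ∧ Γ.DiscreteEulerLagrange L g h :=
  -- Pairing `β̃(dL(g))` with `X` at `β g` is by definition `lieDeriv (Γ.leftProlongation X) L g`;
  -- likewise for `α̃` and the right prolongation.
  Γ.aDual_eq_iff _ _

end SmoothLoopoid

theorem mainTheorem12
    {E E' : Type*} [NormedAddCommGroup E] [NormedSpace ℝ E] [FiniteDimensional ℝ E]
    [NormedAddCommGroup E'] [NormedSpace ℝ E'] [FiniteDimensional ℝ E']
    {G M : Type*} [TopologicalSpace G] [T2Space G] [ChartedSpace E G] [IsManifold 𝓘(ℝ, E) ∞ G]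
    [TopologicalSpace M] [T2Space M] [ChartedSpace E' M] [IsManifold 𝓘(ℝ, E') ∞ M]
    (Γ : SmoothLoopoid E E' G M)
    (L : G → ℝ) (hL : ContMDiff 𝓘(ℝ, E) 𝓘(ℝ, ℝ) ∞ L)
    (n : ℕ) (μ : Fin n → SmoothLoopoid.Cotangent E G) :
    Γ.IsDiscreteLagrangianDynamics L μ ↔
      ∃ g : Fin n → G, (∀ k, μ k = SmoothLoopoid.dL L (g k)) ∧
        ∀ i j : Fin n, (i : ℕ) + 1 = j →
          Γ.β (g i) = Γ.α (g j) ∧ Γ.DiscreteEulerLagrange L (g i) (g j) := by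
  constructor
  · rintro ⟨hμ, hc⟩
    choose g hg using hμ
    refine ⟨g, fun k => (hg k).symm, fun i j hij => ?_⟩
    rw [← Γ.betaTilde_dL_eq_alphaTilde_dL_iff, hg, hg]
    exact hc i j hij
  · rintro ⟨g, hg, hc⟩
    refine ⟨fun k => ⟨g k, (hg k).symm⟩, fun i j hij => ?_⟩
    rw [hg, hg, Γ.betaTilde_dL_eq_alphaTilde_dL_iff]
    exact hc i j hij
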